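/- Let $p$ be a prime, let $t \ge 0$ and $r \ge 2$ be integers, let $a_1, \dots, a_r \in \mathbb{F}_p$ be distinct and let $\theta_1, \dots, \theta_r \in \mathbb{F}_p$. If $r \le \frac{2}{\sqrt5}\sqrt{t} + 1$ and $p > 2t$, then the system of univariate polynomials $\{(x+a_i)^t - \theta_i\}_{1 \le i \le r}$ has at most $\frac{2t}{r-1} + 3$ common roots; the bound holds for the number of common roots in $\mathbb{F}_p$ and, more generally, in any field extension $K$ of $\mathbb{F}_p$. -/

import Mathlib

/-- The polynomial `(x + a) ^ t - θ` over the prime field with `p` elements. -/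
noncomputable def shiftedPowerPoly (p t : ℕ) (a θ : ZMod p) : Polynomial (ZMod p) :=
  (Polynomial.X + Polynomial.C a) ^ t - Polynomial.C θ

/-- The set of common roots, in the `k`-algebra `K`, of a family of univariate polynomials
over `k`. -/
def commonRoots {k ι : Type*} [Field k] (K : Type*) [Field K] [Algebra k K]
    (f : ι → Polynomial k) : Set K :=
  {x : K | ∀ i, Polynomial.aeval x (f i) = 0}

/-!
The proof is Stepanov's method. Put `m = ⌊r / 2⌋`, `μ = m - 1`, `e = ⌊μ / 2⌋`, and look for an
auxiliary polynomial
`F = ∑ i, ∑ j ≤ e, c i j • (X + a i) ^ (t + μ + j)`.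
At a common root `x` one has `(x + a i) ^ t = θ i`, so for `k ≤ μ` the value of the `k`-th
derivative of `F` at `x` is that of a polynomial of degree at most `μ + e - k`, which depends
linearly on `c` and does not depend on `x`. Asking that these polynomials vanish for all `k ≤ μ`
gives fewer equations than the `r * (e + 1)` unknowns, so some `c ≠ 0` makes `F` vanish to order `m`
at every common root (`exists_ne_zero_forall_isRoot_iterate_derivative`). If `F ≠ 0`, then
`m * #roots ≤ deg F ≤ t + μ + e` (`card_mul_le_natDegree`), which is the required bound.

That `F ≠ 0` is a linear independence statement
(`linearIndependent_X_add_C_pow_mul`): products `(X + a i) ^ T * Q i` with `Q i ≠ 0`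
of degree at most `e` are independent when `T` is large. If `n` of them are independent and another
one depends on them, their Wronskian is nonzero (`det_wronskianMatrix_ne_zero`), of degree at most
`n * (T + e)`, and divisible by `(X + a i) ^ (T + 1 - n)` for all `n + 1` indices `i`: for the last
index, exchange one column for the dependent function. These facts are incompatible when
`n * (n + e) ≤ T`.

The Wronskian is handled in positive characteristic by assuming that the factorial of a degree
bound is nonzero in the field, and a generic point is needed, so the argument runs over the
algebraic closure of `K`.
-/

open Polynomial

/-! ### Wronskians of families of polynomials -/

/-- The Wronskian matrix of a finite family of polynomials: column `j` consists of the derivatives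
of `f j` of orders `0, …, n - 1`. -/
noncomputable def wronskianMatrix {R : Type*} [CommRing R] {n : ℕ} (f : Fin n → R[X]) :
    Matrix (Fin n) (Fin n) R[X] :=
  Matrix.of fun k j => derivative^[(k : ℕ)] (f j)

theorem wronskianMatrix_apply {R : Type*} [CommRing R] {n : ℕ} (f : Fin n → R[X])
    (k j : Fin n) : wronskianMatrix f k j = derivative^[(k : ℕ)] (f j) := rfl

theorem natDegree_det_wronskianMatrix_le {R : Type*} [CommRing R] {n d : ℕ} (f : Fin n → R[X])
    (hf : ∀ j, (f j).natDegree ≤ d) : (wronskianMatrix f).det.natDegree ≤ n * d := by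
  rw [Matrix.det_apply]
  refine natDegree_sum_le_of_forall_le _ _ fun σ _ => ?_
  refine (natDegree_smul_le _ _).trans ((natDegree_prod_le _ _).trans ?_)
  calc ∑ i, (wronskianMatrix f (σ i) i).natDegree ≤ ∑ _i : Fin n, d :=
        Finset.sum_le_sum fun i _ =>
          (natDegree_iterate_derivative _ _).trans ((Nat.sub_le _ _).trans (hf i))
    _ = n * d := by simp

theorem Matrix.dvd_det_of_forall_dvd_col {R ι : Type*} [CommRing R] [Fintype ι] [DecidableEq ι]
    {M : Matrix ι ι R} {g : R} (j : ι) (h : ∀ k, g ∣ M k j) : g ∣ M.det := by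
  choose u hu using h
  have hM : M = M.updateCol j (g • u) := by
    ext k l
    by_cases hl : l = j
    · subst hl; simp [hu]
    · simp [hl]
  rw [hM, Matrix.det_updateCol_smul]
  exact dvd_mul_right _ _

theorem natCast_factorial_ne_zero_of_le {L : Type*} [Semiring L] {k d : ℕ} (hkd : k ≤ d)
    (hd : (d.factorial : L) ≠ 0) : (k.factorial : L) ≠ 0 := by
  obtain ⟨u, hu⟩ := Nat.factorial_dvd_factorial hkd
  intro h
  apply hd
  rw [hu, Nat.cast_mul, h, zero_mul]

/-- A polynomial whose derivatives of order `< q` vanish at `c` cannot be a nonzero solution of a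
linear differential equation of order `q` whose leading coefficient does not vanish at `c`. -/
theorem eq_zero_of_sum_mul_iterate_derivative_eq_zero {L : Type*} [Field L] {d q : ℕ}
    (hd : (d.factorial : L) ≠ 0) {v : L[X]} (hv : v.natDegree ≤ d) {c : L} (A : ℕ → L[X])
    (hA : (A q).eval c ≠ 0) (hq : ∀ k < q, (derivative^[k] v).IsRoot c)
    (hL : ∑ k ∈ Finset.range (q + 1), A k * derivative^[k] v = 0) : v = 0 := by
  by_contra hv0
  set μ := v.rootMultiplicity c with hμ
  have hdvd : (X - C c) ^ μ ∣ v := pow_rootMultiplicity_dvd v c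
  have hμd : μ ≤ d := by simpa using (natDegree_le_of_dvd hdvd hv0).trans hv
  have hcop : IsCoprime ((X - C c) ^ (μ + 1 - q)) (A q) := by
    refine IsCoprime.pow_left ((irreducible_X_sub_C c).coprime_iff_not_dvd.2 ?_)
    rwa [dvd_iff_isRoot]
  have hlow : (X - C c) ^ (μ + 1 - q) ∣ A q * derivative^[q] v := by
    rw [Finset.sum_range_succ] at hL
    rw [eq_neg_of_add_eq_zero_right hL, dvd_neg]
    refine Finset.dvd_sum fun k hk => Dvd.dvd.mul_left ?_ _
    have hk := Finset.mem_range.1 hk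
    exact (pow_dvd_pow _ (by omega)).trans (pow_sub_dvd_iterate_derivative_of_pow_dvd k hdvd)
  have hdq := hcop.dvd_of_dvd_mul_left hlow
  have hlt : μ < v.rootMultiplicity c := by
    rw [lt_rootMultiplicity_iff_isRoot_iterate_derivative_of_mem_nonZeroDivisors hv0
      (mem_nonZeroDivisors_of_ne_zero (natCast_factorial_ne_zero_of_le hμd hd))]
    intro k hk
    rcases lt_or_ge k q with hkq | hkq
    · exact hq k hkq
    · have h1 := pow_sub_dvd_iterate_derivative_of_pow_dvd (k - q) hdq
      rw [← Function.iterate_add_apply, Nat.sub_add_cancel hkq] at h1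
      rw [← dvd_iff_isRoot]
      exact (dvd_pow_self _ (by omega)).trans h1
  exact lt_irrefl _ hlt

/-- The Wronskian of linearly independent polynomials of degree at most `d` is nonzero, provided
`d!` is invertible in the field. -/
theorem det_wronskianMatrix_ne_zero {L : Type*} [Field L] [Infinite L] {n d : ℕ}
    (hd : (d.factorial : L) ≠ 0) (f : Fin n → L[X]) (hf : ∀ j, (f j).natDegree ≤ d)
    (hli : LinearIndependent L f) : (wronskianMatrix f).det ≠ 0 := by
  intro hdet
  obtain ⟨A, hA0, hA⟩ := Matrix.exists_vecMul_eq_zero_iff.2 hdet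
  -- `A` is extended by zero to all orders of differentiation; `q` is the order of the operator.
  set B : ℕ → L[X] := fun k => if h : k < n then A ⟨k, h⟩ else 0 with hB
  obtain ⟨i₀, hi₀⟩ := Function.ne_iff.1 hA0
  have hBi (i : Fin n) : B i = A i := by simp [hB]
  classical
  set q := Nat.findGreatest (fun k => B k ≠ 0) n with hqdef
  have hBq : B q ≠ 0 := by
    refine Nat.findGreatest_spec (P := fun k => B k ≠ 0) i₀.2.le ?_
    rw [hBi]; exact hi₀
  have hqn : q < n := by
    by_contra h
    exact hBq (by simp [hB, h])
  have hBgt (k : ℕ) (hk : q < k) (hkn : k ≤ n) : B k = 0 := by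
    by_contra h
    exact Nat.findGreatest_is_greatest (P := fun k => B k ≠ 0) hk hkn h
  have hop (j : Fin n) : ∑ k ∈ Finset.range (q + 1), B k * derivative^[k] (f j) = 0 := by
    have h1 := congrFun hA j
    rw [Matrix.vecMul, dotProduct] at h1
    have h2 : ∑ k ∈ Finset.range n, B k * derivative^[k] (f j) = 0 := by
      rw [Finset.sum_range]
      simpa [hBi, wronskianMatrix_apply] using h1
    rw [← h2]
    refine Finset.sum_subset (fun k hk => ?_) fun k hk hk' => ?_
    · simp only [Finset.mem_range] at hk ⊢; omega
    · simp only [Finset.mem_range] at hk hk'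
      rw [hBgt k (by omega) hk.le, zero_mul]
  obtain ⟨c, hc⟩ : ∃ c, (B q).eval c ≠ 0 := by
    by_contra! h
    exact hBq (Polynomial.funext fun c => by simpa using h c)
  -- The `q < n` conditions at `c` leave a nonzero element of the span.
  let φ : (Fin n → L) →ₗ[L] (Fin q → L) :=
    Fintype.linearCombination L fun j k => (derivative^[(k : ℕ)] (f j)).eval c
  have hker : LinearMap.ker φ ≠ ⊥ := LinearMap.ker_ne_bot_of_finrank_lt (by simpa using hqn)
  obtain ⟨w, hw, hw0⟩ := (Submodule.ne_bot_iff _).1 hker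
  have hder (k : ℕ) : derivative^[k] (∑ j, w j • f j) = ∑ j, w j • derivative^[k] (f j) := by
    rw [iterate_derivative_sum]
    exact Finset.sum_congr rfl fun j _ => iterate_derivative_smul _ _ _
  have hv : ∑ j, w j • f j = 0 := by
    refine eq_zero_of_sum_mul_iterate_derivative_eq_zero hd ?_ B hc ?_ ?_
    · exact natDegree_sum_le_of_forall_le _ _ fun j _ => (natDegree_smul_le _ _).trans (hf j)
    · intro k hk
      have h1 := congrFun (LinearMap.mem_ker.1 hw) ⟨k, hk⟩
      rw [Fintype.linearCombination_apply, Finset.sum_apply] at h1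
      rw [IsRoot, hder, eval_finsetSum]
      simpa using h1
    · simp_rw [hder, Finset.mul_sum, mul_smul_comm]
      rw [Finset.sum_comm]
      refine Finset.sum_eq_zero fun j _ => ?_
      rw [← Finset.smul_sum, hop, smul_zero]
  exact hw0 (funext (Fintype.linearIndependent_iff.1 hli w hv))

/-! ### Linear independence of multiples of shifted powers -/

/-- Multiples of `T`-th powers of distinct linear polynomials with cofactors of degree at most `e`
are linearly independent when `T` is large in terms of `e` and of their number. -/
theorem linearIndependent_X_add_C_pow_mul {L : Type*} [Field L] [Infinite L] {T e s : ℕ}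
    (hfac : ((T + e).factorial : L) ≠ 0) (hT : s * (s + e) ≤ T) :
    ∀ {n : ℕ}, n ≤ s + 1 → ∀ (a : Fin n → L) (Q : Fin n → L[X]), Function.Injective a →
      (∀ i, Q i ≠ 0) → (∀ i, (Q i).natDegree ≤ e) →
      LinearIndependent L fun i => (X + C (a i)) ^ T * Q i := by
  intro n
  induction n with
  | zero => intro _ a Q _ _ _; exact linearIndependent_empty_type
  | succ n ih =>
    intro hn a Q ha hQ0 hQ
    set f : Fin (n + 1) → L[X] := fun i => (X + C (a i)) ^ T * Q i with hf
    have hdeg (i : Fin (n + 1)) : (f i).natDegree ≤ T + e := by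
      refine natDegree_mul_le.trans (add_le_add ?_ (hQ i))
      exact natDegree_pow_le.trans (by simp)
    have hli : LinearIndependent L (Fin.tail f) :=
      ih (by omega) (Fin.tail a) (Fin.tail Q) (ha.comp (Fin.succ_injective n))
        (fun i => hQ0 _) (fun i => hQ _)
    refine linearIndependent_finSucc.2 ⟨hli, fun hmem => ?_⟩
    obtain ⟨c, hc⟩ := (Submodule.mem_span_range_iff_exists_fun L).1 hmem
    have hf0 : f 0 ≠ 0 := mul_ne_zero (pow_ne_zero _ (X_add_C_ne_zero _)) (hQ0 0)
    obtain ⟨i₀, hi₀⟩ : ∃ i, c i ≠ 0 := by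
      by_contra! h
      exact hf0 (by rw [← hc]; simp [h])
    set W := wronskianMatrix (Fin.tail f)
    have hW : W.det ≠ 0 := det_wronskianMatrix_ne_zero hfac _ (fun j => hdeg _) hli
    have hent (i : Fin (n + 1)) (k : Fin n) :
        (X + C (a i)) ^ (T + 1 - n) ∣ derivative^[(k : ℕ)] (f i) :=
      (pow_dvd_pow _ (by omega)).trans
        (pow_sub_dvd_iterate_derivative_of_pow_dvd (k : ℕ) (dvd_mul_right _ (Q i)))
    have hdvd (i : Fin (n + 1)) : (X + C (a i)) ^ (T + 1 - n) ∣ W.det := by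
      refine Fin.cases ?_ (fun j => ?_) i
      · -- Exchanging column `i₀` for the dependent function multiplies `W.det` by `c i₀`.
        have h1 : (X + C (a 0)) ^ (T + 1 - n) ∣
            (W.updateCol i₀ fun k => ∑ j, C (c j) • W k j).det := by
          refine Matrix.dvd_det_of_forall_dvd_col i₀ fun k => ?_
          have h2 : ∑ j, C (c j) • W k j = derivative^[(k : ℕ)] (f 0) := by
            rw [← hc, iterate_derivative_sum]
            refine Finset.sum_congr rfl fun j _ => ?_
            rw [iterate_derivative_smul, smul_eq_mul, ← smul_eq_C_mul]
            rfl
          rw [Matrix.updateCol_self, h2]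
          exact hent 0 k
        rw [Matrix.det_updateCol_sum, smul_eq_mul] at h1
        exact ((isUnit_C.2 hi₀.isUnit).dvd_mul_left).1 h1
      · exact Matrix.dvd_det_of_forall_dvd_col j fun k => hent j.succ k
    have hprod : ∏ i, (X + C (a i)) ^ (T + 1 - n) ∣ W.det := by
      refine Fintype.prod_dvd_of_coprime (fun i j hij => ?_) hdvd
      refine IsCoprime.pow ?_
      have := pairwise_coprime_X_sub_C (s := fun i => -a i) (neg_injective.comp ha) hij
      simpa [Function.onFun] using this
    have hle := natDegree_le_of_dvd hprod hW
    rw [natDegree_prod _ _ fun i _ => pow_ne_zero _ (X_add_C_ne_zero _)] at hle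
    have hle2 : (n + 1) * (T + 1 - n) ≤ n * (T + e) := by
      refine le_trans (le_of_eq ?_)
        (hle.trans (natDegree_det_wronskianMatrix_le _ fun j => hdeg j.succ))
      simp
    have hns : n * (n + e) ≤ T :=
      (Nat.mul_le_mul (by omega) (by omega)).trans hT
    have hnT : n ≤ T + 1 := by nlinarith
    zify [hnT] at hle2 hns
    nlinarith

theorem sum_X_add_C_pow_mul_ne_zero {L : Type*} [Field L] [Infinite L] {T e s : ℕ}
    (hfac : ((T + e).factorial : L) ≠ 0) (hT : s * (s + e) ≤ T) {r : ℕ} (hr : r ≤ s + 1)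
    (a : Fin r → L) (Q : Fin r → L[X]) (ha : Function.Injective a)
    (hQ : ∀ i, (Q i).natDegree ≤ e) {i₀ : Fin r} (hi₀ : Q i₀ ≠ 0) :
    ∑ i, (X + C (a i)) ^ T * Q i ≠ 0 := by
  classical
  intro h0
  let ε := (Fintype.equivFin {i // Q i ≠ 0}).symm
  have hcard : Fintype.card {i // Q i ≠ 0} ≤ s + 1 :=
    (Fintype.card_subtype_le _).trans (by simpa using hr)
  have hli := linearIndependent_X_add_C_pow_mul hfac hT hcard (fun j => a (ε j))
    (fun j => Q (ε j)) (ha.comp (Subtype.val_injective.comp ε.injective))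
    (fun j => (ε j).2) (fun j => hQ _)
  have hsum : ∑ j, (1 : L) • ((X + C (a (ε j))) ^ T * Q (ε j)) = 0 := by
    simp only [one_smul]
    rw [ε.sum_comp fun i : {i // Q i ≠ 0} => (X + C (a i)) ^ T * Q i,
      ← Finset.sum_subtype (Finset.univ.filter (Q · ≠ 0)) (by simp)
        fun i => (X + C (a i)) ^ T * Q i]
    exact (Finset.sum_filter_of_ne fun i _ h => right_ne_zero_of_mul h).trans h0
  exact one_ne_zero (Fintype.linearIndependent_iff.1 hli (fun _ => 1) hsum (ε.symm ⟨i₀, hi₀⟩))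

/-! ### The auxiliary polynomial -/

theorem card_mul_le_natDegree {L : Type*} [Field L] {m : ℕ} (hm : (m.factorial : L) ≠ 0)
    {F : L[X]} (hF : F ≠ 0) (S : Finset L)
    (hS : ∀ x ∈ S, ∀ k ≤ m, (derivative^[k] F).IsRoot x) :
    S.card * (m + 1) ≤ F.natDegree := by
  have hdvd : ∏ x ∈ S, (X - C x) ^ (m + 1) ∣ F := by
    refine Finset.prod_dvd_of_coprime (fun x _ y _ hxy => ?_) fun x hx => ?_
    · exact (pairwise_coprime_X_sub_C Function.injective_id hxy).pow
    · rw [← le_rootMultiplicity_iff hF, Nat.succ_le_iff,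
        lt_rootMultiplicity_iff_isRoot_iterate_derivative_of_mem_nonZeroDivisors hF
          (mem_nonZeroDivisors_of_ne_zero hm)]
      exact hS x hx
  have h := natDegree_le_of_dvd hdvd hF
  rw [natDegree_prod _ _ fun x _ => pow_ne_zero _ (X_sub_C_ne_zero x)] at h
  simpa using h

/-- Existence of Stepanov's auxiliary polynomial. For each order of differentiation `k ≤ μ`, the
vanishing of the `μ + e - k + 1` coefficients of a single polynomial forces the `k`-th derivative
to vanish at all common roots. -/
theorem exists_ne_zero_forall_isRoot_iterate_derivative {L : Type*} [Field L] {t r μ e : ℕ}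
    (a θ : Fin r → L)
    (hcount : ∑ k : Fin (μ + 1), (μ + e - k + 1) < r * (e + 1)) :
    ∃ c : Fin r × Fin (e + 1) → L, c ≠ 0 ∧
      ∀ x, (∀ i, (x + a i) ^ t = θ i) → ∀ k ≤ μ,
        (derivative^[k] (∑ ij, c ij • (X + C (a ij.1)) ^ (t + μ + ij.2))).IsRoot x := by
  let b (k : ℕ) (ij : Fin r × Fin (e + 1)) : L[X] :=
    (((t + μ + ij.2).descFactorial k : L) * θ ij.1) • (X + C (a ij.1)) ^ (μ + ij.2 - k)
  let φ : (Fin r × Fin (e + 1) → L) →ₗ[L]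
      ((Σ k : Fin (μ + 1), Fin (μ + e - k + 1)) → L) :=
    Fintype.linearCombination L fun ij kl => (b kl.1 ij).coeff kl.2
  have hker : LinearMap.ker φ ≠ ⊥ :=
    LinearMap.ker_ne_bot_of_finrank_lt (by simpa using hcount)
  obtain ⟨c, hc, hc0⟩ := (Submodule.ne_bot_iff _).1 hker
  refine ⟨c, hc0, fun x hx k hk => ?_⟩
  have hP : ∑ ij, c ij • b k ij = 0 := by
    refine (Polynomial.ext_iff_natDegree_le (n := μ + e - k) ?_ (by simp)).2 fun l hl => ?_
    · refine natDegree_sum_le_of_forall_le _ _ fun ij _ => ?_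
      refine (natDegree_smul_le _ _).trans ((natDegree_smul_le _ _).trans ?_)
      have := ij.2.2
      refine natDegree_pow_le.trans ?_
      rw [natDegree_X_add_C]
      omega
    · have h1 := congrFun (LinearMap.mem_ker.1 hc)
        ⟨⟨k, by omega⟩, ⟨l, by dsimp only; omega⟩⟩
      rw [Fintype.linearCombination_apply, Finset.sum_apply] at h1
      simpa [finsetSum_coeff] using h1
  have hev := congrArg (eval x) hP
  rw [IsRoot, iterate_derivative_sum, ← eval_zero (x := x), ← hev, eval_finsetSum,
    eval_finsetSum]
  refine Finset.sum_congr rfl fun ij _ => ?_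
  rw [iterate_derivative_smul, iterate_derivative_X_add_pow,
    show t + μ + (ij.2 : ℕ) - k = t + (μ + ij.2 - k) by omega]
  simp only [b, eval_smul, eval_pow, eval_add, eval_X, eval_C, smul_eq_mul, nsmul_eq_mul,
    eval_mul, eval_natCast, pow_add _ t, hx ij.1]
  ring

/-- The multiplicity estimate, with the order of vanishing `μ + 1` and the degree parameter `e`
left free. -/
theorem card_mul_le_of_forall_pow_eq {L : Type*} [Field L] [Infinite L] {t s μ e : ℕ}
    (a θ : Fin (s + 1) → L) (ha : Function.Injective a)
    (hfac : ((t + μ + e).factorial : L) ≠ 0) (hT : s * (s + e) ≤ t + μ)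
    (hcount : ∑ k : Fin (μ + 1), (μ + e - k + 1) < (s + 1) * (e + 1))
    (S : Finset L) (hS : ∀ x ∈ S, ∀ i, (x + a i) ^ t = θ i) :
    S.card * (μ + 1) ≤ t + μ + e := by
  obtain ⟨c, hc0, hc⟩ :=
    exists_ne_zero_forall_isRoot_iterate_derivative (t := t) a θ hcount
  obtain ⟨⟨i₀, j₀⟩, hij⟩ := Function.ne_iff.1 hc0
  set F := ∑ ij : Fin (s + 1) × Fin (e + 1), c ij • (X + C (a ij.1)) ^ (t + μ + ij.2) with hF
  let G (i : Fin (s + 1)) : L[X] := ∑ j : Fin (e + 1), monomial (j : ℕ) (c (i, j))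
  have hG : G i₀ ≠ 0 := by
    intro h
    apply hij
    have h1 := congrArg (fun P => coeff P j₀) h
    simpa [G, finsetSum_coeff, coeff_monomial, Fin.val_inj] using h1
  have hFG : F = ∑ i, (X + C (a i)) ^ (t + μ) * (G i).comp (X + C (a i)) := by
    rw [hF, Fintype.sum_prod_type]
    refine Finset.sum_congr rfl fun i _ => ?_
    rw [sum_comp, Finset.mul_sum]
    refine Finset.sum_congr rfl fun j _ => ?_
    rw [monomial_comp, smul_eq_C_mul, pow_add]
    ring
  have hF0 : F ≠ 0 := by
    rw [hFG]
    refine sum_X_add_C_pow_mul_ne_zero (e := e) hfac hT le_rfl a _ ha (fun i => ?_) (i₀ := i₀) ?_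
    · rw [natDegree_comp, natDegree_X_add_C, mul_one]
      refine natDegree_sum_le_of_forall_le _ _ fun j _ => (natDegree_monomial_le _).trans ?_
      omega
    · rwa [Ne, comp_X_add_C_eq_zero_iff]
  refine (card_mul_le_natDegree
    (natCast_factorial_ne_zero_of_le (by omega) hfac) hF0 S fun x hx => hc x (hS x hx)).trans ?_
  refine natDegree_sum_le_of_forall_le _ _ fun ij _ => (natDegree_smul_le _ _).trans ?_
  refine natDegree_pow_le.trans ?_
  rw [natDegree_X_add_C]
  omega

/-! ### Choice of parameters -/

theorem sum_fin_add_sub_add_one_mul_two (μ e : ℕ) :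
    (∑ k : Fin (μ + 1), (μ + e - k + 1)) * 2 = (μ + 1) * (μ + 2 * e + 2) := by
  rw [Fin.sum_univ_eq_sum_range fun k => μ + e - k + 1,
    ← Finset.sum_range_reflect]
  have : ∀ k ∈ Finset.range (μ + 1), μ + e - (μ + 1 - 1 - k) + 1 = (e + 1) + k := fun k hk => by
    have := Finset.mem_range.1 hk
    omega
  rw [Finset.sum_congr rfl this, Finset.sum_add_distrib, add_mul, Finset.sum_range_id_mul_two]
  simp
  ring

/-- The bound over an infinite field of characteristic `p`, cleared of denominators, for a system
of `s + 1` equations. -/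
theorem card_mul_le_of_infinite {L : Type*} [Field L] [Infinite L] (p : ℕ) [Fact p.Prime]
    [CharP L p] {t s : ℕ} (hs : 1 ≤ s) (a θ : Fin (s + 1) → L) (ha : Function.Injective a)
    (hst : 5 * s ^ 2 ≤ 4 * t) (hpt : 2 * t < p)
    (S : Finset L) (hS : ∀ x ∈ S, ∀ i, (x + a i) ^ t = θ i) :
    S.card * s ≤ 2 * t + 3 * s := by
  obtain ⟨μ, hμ⟩ : ∃ μ, (s + 1) / 2 = μ + 1 := ⟨(s + 1) / 2 - 1, by omega⟩
  set e := μ / 2 with he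
  have hs1 : s ≤ 2 * μ + 2 := by omega
  have hs2 : 2 * μ + 1 ≤ s := by omega
  have he1 : 2 * e ≤ μ := by omega
  have he2 : μ ≤ 2 * e + 1 := by omega
  have hmain : S.card * (μ + 1) ≤ t + μ + e := by
    refine card_mul_le_of_forall_pow_eq a θ ha ?_ ?_ ?_ S hS
    · rw [Ne, CharP.cast_eq_zero_iff L p, (Fact.out : p.Prime).dvd_factorial]
      nlinarith
    · -- As `4 * e ≤ s - 1`, this is where `5 * s ^ 2 ≤ 4 * t` is needed.
      nlinarith
    · -- Here `2 * (μ + 1) ≤ s + 1` and `μ ≤ 2 * e + 1` make the unknowns outnumber the equations.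
      have := sum_fin_add_sub_add_one_mul_two μ e
      nlinarith
  nlinarith

theorem mainTheorem2 (p : ℕ) [Fact p.Prime] (K : Type*) [Field K] [Algebra (ZMod p) K]
    (t r : ℕ) (hr : 2 ≤ r) (a θ : Fin r → ZMod p) (ha : Function.Injective a)
    (hrt : (r : ℝ) ≤ 2 / Real.sqrt 5 * Real.sqrt (t : ℝ) + 1) (hpt : 2 * t < p) :
    (commonRoots K (fun i : Fin r => shiftedPowerPoly p t (a i) (θ i))).Finite ∧
      ((commonRoots K (fun i : Fin r => shiftedPowerPoly p t (a i) (θ i))).ncard : ℝ) ≤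
        2 * (t : ℝ) / ((r : ℝ) - 1) + 3 := by
  obtain ⟨s, rfl⟩ : ∃ s, r = s + 1 := ⟨r - 1, by omega⟩
  have hs : 1 ≤ s := by omega
  have hst : 5 * s ^ 2 ≤ 4 * t := by
    have h1 : (s : ℝ) ≤ 2 / Real.sqrt 5 * Real.sqrt t := by push_cast at hrt; linarith
    have h2 := pow_le_pow_left₀ (Nat.cast_nonneg s) h1 2
    rw [mul_pow, div_pow, Real.sq_sqrt (by norm_num), Real.sq_sqrt (Nat.cast_nonneg t)] at h2
    have h3 : (5 * s ^ 2 : ℝ) ≤ 4 * t := by linarith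
    exact_mod_cast h3
  have ht : t ≠ 0 := by rintro rfl; nlinarith
  set R := commonRoots K (fun i => shiftedPowerPoly p t (a i) (θ i)) with hR
  have hmem (x : K) : x ∈ R ↔
      ∀ i, (x + algebraMap (ZMod p) K (a i)) ^ t = algebraMap (ZMod p) K (θ i) := by
    simp [hR, commonRoots, shiftedPowerPoly, sub_eq_zero]
  have hfin : R.Finite := by
    classical
    refine ((nthRoots t (algebraMap (ZMod p) K (θ 0))).toFinset.finite_toSet.preimage
      (add_left_injective (algebraMap (ZMod p) K (a 0))).injOn).subset fun x hx => ?_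
    simpa [mem_nthRoots (Nat.pos_of_ne_zero ht)] using (hmem x).1 hx 0
  refine ⟨hfin, ?_⟩
  -- The auxiliary polynomial argument needs an infinite field.
  let L := AlgebraicClosure K
  have : CharP L p := charP_of_injective_algebraMap (algebraMap (ZMod p) L).injective p
  let ι : K ↪ L := ⟨algebraMap K L, (algebraMap K L).injective⟩
  have hcard := card_mul_le_of_infinite (L := L) p hs (fun i => algebraMap (ZMod p) L (a i))
    (fun i => algebraMap (ZMod p) L (θ i)) ((algebraMap (ZMod p) L).injective.comp ha) hst hpt
    (hfin.toFinset.map ι) (by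
      intro y hy i
      obtain ⟨x, hx, rfl⟩ := Finset.mem_map.1 hy
      have := congrArg (algebraMap K L) ((hmem x).1 (hfin.mem_toFinset.1 hx) i)
      rwa [map_pow, map_add, ← IsScalarTower.algebraMap_apply,
        ← IsScalarTower.algebraMap_apply] at this)
  rw [Finset.card_map, ← Set.ncard_eq_toFinset_card R hfin] at hcard
  have hs0 : (0 : ℝ) < s := by exact_mod_cast hs
  push_cast
  rw [add_sub_cancel_right, ← sub_le_iff_le_add, le_div_iff₀ hs0]
  have : (R.ncard * s : ℝ) ≤ 2 * t + 3 * s := by exact_mod_cast hcard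
  linarith
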